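/- Let $\alpha\in[0,1)$ and $b\in(0,1)$. For integers $n\ge 1$ and $0<x\le 1$ put $$\Lambda_n(x)=\frac1x\int_0^{\infty}\frac{J_n(xt)\,J_n(t)}{t^{1-\alpha}}\,dt,\qquad \Theta_n=\Lambda_1(1)-\Lambda_n(1),$$ where $J_n(z)=\sum_{k\ge0}\frac{(-1)^k}{k!\,(n+k)!}\left(\frac z2\right)^{2k+n}$ is the Bessel function of the first kind. For $\Omega\in\mathbb R$ and $n\ge2$ let $$M_n^\alpha=\begin{pmatrix}\Omega-\Theta_n+b^2\Lambda_1(b) & -b^2\Lambda_n(b)\\ b\Lambda_n(b) & b\,\Omega+b^{1-\alpha}\Theta_n-b\Lambda_1(b)\end{pmatrix},$$ $$C_n=1+(b^{-\alpha}-1)\Theta_n-(1-b^2)\Lambda_1(b),\qquad \Delta_n=\big((b^{-\alpha}+1)\Theta_n-(1+b^2)\Lambda_1(b)\big)^2-4b^2\Lambda_n^2(b),$$ and $\lambda_n^{\pm}=C_n\pm\sqrt{\Delta_n}$ whenever $\Delta_n\ge 0$. Then there is an integer $N\ge2$, namely the smallest integer $N\ge 2$ with $$\Theta_N\ \ge\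 \frac{1+b^2}{b^{-\alpha}+1}\Lambda_1(b)+\frac{2b}{b^{-\alpha}+1}\Lambda_N(b),$$ such that $\Delta_N\ge0$ and the following hold. 1. For all $n>N$ one has $\Delta_n>0$, and the equation $\det M_n^\alpha=0$, in the unknown $\lambda=1-2\Omega$, has exactly two real solutions, which are distinct and equal to $\lambda_n^-$ and $\lambda_n^+$. 2. The sequences $(\Delta_n)_{n\ge N}$ and $(\lambda_n^+)_{n\ge N}$ are strictly increasing, and $(\lambda_n^-)_{n\ge N}$ is strictly decreasing. 3. For all integers $m>n>N$, $\ \lambda_m^-<\lambda_n^-<\lambda_n^+<\lambda_m^+$. -/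

import Mathlib

namespace GSQG

/-- The Bessel function of the first kind of order `n ∈ ℕ`, on the real line,
`J_n(x) = ∑_{k ≥ 0} (-1)^k / (k! (n+k)!) (x/2)^(2k+n)` (an everywhere absolutely convergent
series). -/
noncomputable def besselJ (n : ℕ) (x : ℝ) : ℝ :=
  ∑' k : ℕ, (-1 : ℝ) ^ k / ((k.factorial : ℝ) * ((n + k).factorial : ℝ)) * (x / 2) ^ (2 * k + n)

/-- `Λ_n(b) = (1/b) ∫_0^∞ J_n(b t) J_n(t) t^(α-1) dt`. For `0 < b ≤ 1`, `0 ≤ α < 1` and `n ≥ 1`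
the integral converges absolutely. -/
noncomputable def Lam (α : ℝ) (n : ℕ) (b : ℝ) : ℝ :=
  1 / b * ∫ t in Set.Ioi (0 : ℝ), besselJ n (b * t) * besselJ n t / t ^ (1 - α)

/-- `Θ_n = Λ_1(1) - Λ_n(1)`. -/
noncomputable def Theta (α : ℝ) (n : ℕ) : ℝ := Lam α 1 1 - Lam α n 1

/-- The matrix `M_n^α` of the linearized operator at frequency `n` and angular velocity `Ω`. -/
noncomputable def M (α b Ω : ℝ) (n : ℕ) : Matrix (Fin 2) (Fin 2) ℝ :=
  !![Ω - Theta α n + b ^ 2 * Lam α 1 b, -(b ^ 2 * Lam α n b);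
     b * Lam α n b, b * Ω + b ^ (1 - α) * Theta α n - b * Lam α 1 b]

/-- `C_n = 1 + (b^(-α) - 1) Θ_n - (1 - b²) Λ_1(b)`. -/
noncomputable def C (α b : ℝ) (n : ℕ) : ℝ :=
  1 + (b ^ (-α) - 1) * Theta α n - (1 - b ^ 2) * Lam α 1 b

/-- The (reduced) discriminant
`Δ_n = ((b^(-α) + 1) Θ_n - (1 + b²) Λ_1(b))² - 4 b² Λ_n(b)²`. -/
noncomputable def Delta (α b : ℝ) (n : ℕ) : ℝ :=
  ((b ^ (-α) + 1) * Theta α n - (1 + b ^ 2) * Lam α 1 b) ^ 2 - 4 * b ^ 2 * Lam α n b ^ 2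

/-- `λ_n^+ = C_n + √Δ_n`. -/
noncomputable def lamPlus (α b : ℝ) (n : ℕ) : ℝ := C α b n + √(Delta α b n)

/-- `λ_n^- = C_n - √Δ_n`. -/
noncomputable def lamMinus (α b : ℝ) (n : ℕ) : ℝ := C α b n - √(Delta α b n)

/-- The frequency threshold condition
`Θ_n ≥ (1 + b²)/(b^(-α) + 1) Λ_1(b) + 2b/(b^(-α) + 1) Λ_n(b)`. -/
def Threshold (α b : ℝ) (n : ℕ) : Prop :=
  (1 + b ^ 2) / (b ^ (-α) + 1) * Lam α 1 b + 2 * b / (b ^ (-α) + 1) * Lam α n b ≤ Theta α n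

end GSQG

/-!
Since `t^(α - 1)` is a constant times the integral of `t exp(-p t²)` against `p^(-α/2) dp`, Weber's
formula turns the integral defining `Λ_n` into the integral of `p^(-α/2)` against the kernel
`(2p)⁻¹ exp(-(a² + c²) / (4p)) I_n(a c / (2p))`, where everything is positive. The expansion
`exp(z) I_n(z) = ∑_M (z/2)^M / M! * C(2M, M + n)` shows that `I_n(z)` decreases in `n`, so `Λ_n`
decreases to `0` and `Θ_n` increases to `Λ_1(1)`. As `I_1(z) / z` increases with `z`, comparing
`(a, c) = (b, 1)` with the diagonal point having the same `a² + c²` gives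
`(1 + b²) Λ_1(b) < (b^(-α) + 1) Λ_1(1)`, which makes the threshold condition hold for large `n`.
Above the threshold `√Δ_n` grows at least as fast as `(b^(-α) + 1) Θ_n`, which beats the growth
`(b^(-α) - 1) Θ_n` of the centre `C_n`.
-/

namespace GSQG

open Filter Finset MeasureTheory Set
open scoped Nat Topology

lemma hasSum_mul_prod {ι κ : Type*} {f : ι → ℝ} {g : κ → ℝ} {s t : ℝ} (hf : HasSum f s)
    (hg : HasSum g t) : HasSum (fun q : ι × κ => f q.1 * g q.2) (s * t) :=
  hf.mul hg (summable_mul_of_summable_norm hf.summable.norm hg.summable.norm)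

section BesselClifford

/-- The Bessel–Clifford function `∑ₖ yᵏ / (k! (n + k)!)`, the common entire factor of
`J_n(x) = (x/2)ⁿ besselClifford n (-(x/2)²)` and `I_n(x) = (x/2)ⁿ besselClifford n ((x/2)²)`. -/
noncomputable def besselClifford (n : ℕ) (y : ℝ) : ℝ :=
  ∑' k : ℕ, y ^ k / (k ! * (n + k)! : ℝ)

variable (n : ℕ)

lemma hasSum_pow_div_factorial (x : ℝ) : HasSum (fun k : ℕ => x ^ k / (k ! : ℝ)) (Real.exp x) :=
  Real.exp_eq_exp_ℝ ▸ NormedSpace.expSeries_div_hasSum_exp x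

lemma summable_besselClifford (y : ℝ) :
    Summable fun k : ℕ => y ^ k / (k ! * (n + k)! : ℝ) := by
  refine .of_norm_bounded (hasSum_pow_div_factorial |y|).summable fun k => ?_
  have one_le : (1 : ℝ) ≤ (n + k)! := mod_cast (n + k).factorial_pos
  rw [norm_div, norm_pow, Real.norm_eq_abs, Real.norm_of_nonneg (by positivity)]
  gcongr
  exact le_mul_of_one_le_right (by positivity) one_le

lemma hasSum_besselClifford (y : ℝ) :
    HasSum (fun k : ℕ => y ^ k / (k ! * (n + k)! : ℝ)) (besselClifford n y) :=
  (summable_besselClifford n y).hasSum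

lemma besselClifford_pos {y : ℝ} (hy : 0 ≤ y) : 0 < besselClifford n y :=
  (summable_besselClifford n y).tsum_pos (fun k => by positivity) 0 (by positivity)

lemma besselClifford_strictMonoOn : StrictMonoOn (besselClifford n) (Ici 0) := by
  intro x hx y _ hxy
  have hx : 0 ≤ x := hx
  exact (summable_besselClifford n x).tsum_lt_tsum (i := 1) (fun k => by gcongr)
    (by simp only [pow_one]; gcongr) (summable_besselClifford n y)

lemma factorial_mul_factorial_two_mul_le (k : ℕ) : n ! * (2 * k)! ≤ 4 ^ k * (k ! * (n + k)!) :=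
  calc n ! * (2 * k)! = k.centralBinom * k ! * (n ! * k !) := by
        rw [← Nat.choose_mul_factorial_mul_factorial (show k ≤ 2 * k by omega),
          Nat.centralBinom_eq_two_mul_choose, show 2 * k - k = k by omega]
        ring
    _ ≤ 4 ^ k * k ! * (n + k)! := by
        gcongr
        · exact k.centralBinom_le_four_pow
        · exact Nat.le_of_dvd (by positivity) (Nat.factorial_mul_factorial_dvd_factorial_add n k)
    _ = _ := by ring

lemma besselClifford_sq_le (x : ℝ) : besselClifford n ((x / 2) ^ 2) ≤ Real.cosh x / n ! := by
  refine hasSum_le (fun k => ?_) (hasSum_besselClifford n _) (x.hasSum_cosh.div_const _)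
  have factorials_le : (n ! * (2 * k)! : ℝ) ≤ 4 ^ k * (k ! * (n + k)!) :=
    mod_cast factorial_mul_factorial_two_mul_le n k
  have pow_nonneg : 0 ≤ x ^ (2 * k) := (even_two_mul k).pow_nonneg x
  calc ((x / 2) ^ 2) ^ k / (k ! * (n + k)! : ℝ) = x ^ (2 * k) / (4 ^ k * (k ! * (n + k)!)) := by
        rw [div_pow, div_pow, ← pow_mul, div_div]; norm_num
    _ ≤ x ^ (2 * k) / (n ! * (2 * k)!) := by gcongr
    _ = x ^ (2 * k) / (2 * k)! / n ! := by rw [div_div, mul_comm (n ! : ℝ)]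

lemma measurable_besselClifford : Measurable (besselClifford n) :=
  measurable_of_tendsto_metrizable
    (f := fun N y => ∑ k ∈ range N, y ^ k / (k ! * (n + k)! : ℝ)) (fun N => by fun_prop)
    (tendsto_pi_nhds.2 fun y => (hasSum_besselClifford n y).tendsto_sum_nat)

lemma besselJ_eq_pow_mul_besselClifford (x : ℝ) :
    besselJ n x = (x / 2) ^ n * besselClifford n (-(x / 2) ^ 2) := by
  rw [besselJ, besselClifford, ← tsum_mul_left]
  congr with k
  rw [neg_pow ((x / 2) ^ 2), ← pow_mul, pow_add]
  ring

@[fun_prop]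
lemma measurable_besselJ : Measurable (besselJ n) := by
  have := measurable_besselClifford n
  rw [funext (besselJ_eq_pow_mul_besselClifford n)]
  fun_prop

lemma hasSum_besselJ_mul_besselJ (a c t : ℝ) :
    HasSum (fun q : ℕ × ℕ => (a * c / 4) ^ n * ((-(a / 2) ^ 2) ^ q.1 * (-(c / 2) ^ 2) ^ q.2) /
        (q.1 ! * (n + q.1)! * (q.2 ! * (n + q.2)!)) * t ^ (2 * (n + q.1 + q.2)))
      (besselJ n (a * t) * besselJ n (c * t)) := by
  have hprod := (hasSum_mul_prod (hasSum_besselClifford n (-(a * t / 2) ^ 2))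
    (hasSum_besselClifford n (-(c * t / 2) ^ 2))).mul_left ((a * t / 2) ^ n * (c * t / 2) ^ n)
  rw [← mul_mul_mul_comm, ← besselJ_eq_pow_mul_besselClifford,
    ← besselJ_eq_pow_mul_besselClifford] at hprod
  refine hprod.congr_fun fun q => ?_
  rw [← mul_pow, show a * t / 2 * (c * t / 2) = a * c / 4 * t ^ 2 by ring,
    show -(a * t / 2) ^ 2 = -(a / 2) ^ 2 * t ^ 2 by ring,
    show -(c * t / 2) ^ 2 = -(c / 2) ^ 2 * t ^ 2 by ring]
  ring

lemma sum_choose_mul_choose_add (j k : ℕ) :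
    ∑ m ∈ range (j + 1), j.choose m * (n + k).choose (n + m) = (n + j + k).choose (n + j) := by
  rw [show n + j + k = j + (n + k) by ring, Nat.add_choose_eq,
    Nat.sum_antidiagonal_eq_sum_range_succ_mk,
    ← sum_subset (range_mono (show j.succ ≤ (n + j).succ by omega)),
    ← sum_range_reflect]
  · refine sum_congr rfl fun m hm => ?_
    have hm : m ≤ j := Nat.lt_succ_iff.1 (Finset.mem_range.1 hm)
    dsimp only
    rw [Nat.add_sub_cancel, Nat.choose_symm hm, show n + (j - m) = n + j - m by omega]
  · intro m _ hm
    rw [Nat.choose_eq_zero_of_lt (by simpa using hm), zero_mul]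

lemma hasSum_exp_mul_exp_mul_besselClifford (x y : ℝ) :
    HasSum (fun q : ℕ × ℕ => x ^ q.1 * y ^ q.2 *
        ((n + q.1 + q.2)! / (q.1 ! * (n + q.1)! * (q.2 ! * (n + q.2)!)) : ℝ))
      (Real.exp x * Real.exp y * besselClifford n (x * y)) := by
  -- Expand into a triple series over `((i, l), m)` and collect the terms with a given
  -- `(i + m, l + m)`: the remaining sum over `m` is a Vandermonde convolution.
  have htriple := hasSum_mul_prod (hasSum_mul_prod (hasSum_pow_div_factorial x)
    (hasSum_pow_div_factorial y)) (hasSum_besselClifford n (x * y))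
  let shift : (ℕ × ℕ) × ℕ → (ℕ × ℕ) × ℕ := fun q => ((q.1.1 + q.2, q.1.2 + q.2), q.2)
  have shift_injective : Function.Injective shift := by
    rintro ⟨⟨i, l⟩, m⟩ ⟨⟨i', l'⟩, m'⟩ h
    simp only [shift, Prod.mk.injEq] at h ⊢
    omega
  let term : (ℕ × ℕ) × ℕ → ℝ := fun q => x ^ q.1.1 * y ^ q.1.2 *
    ((q.1.1.choose q.2 * (n + q.1.2).choose (n + q.2) : ℕ) / (q.1.1 ! * (n + q.1.2)!) : ℝ)
  have hterm : HasSum term (Real.exp x * Real.exp y * besselClifford n (x * y)) := by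
    rw [← shift_injective.hasSum_iff]
    · refine htriple.congr_fun ?_
      rintro ⟨⟨i, l⟩, m⟩
      simp only [Function.comp_apply, term, shift]
      rw [show n + (l + m) = l + (n + m) by ring, Nat.cast_mul,
        ← Nat.choose_symm_add, Nat.cast_add_choose, ← Nat.choose_symm_add, Nat.cast_add_choose]
      field_simp
      ring
    · rintro ⟨⟨j, k⟩, m⟩ hq
      suffices choose_eq_zero : j.choose m * (n + k).choose (n + m) = 0 by
        simp only [term, choose_eq_zero, Nat.cast_zero, zero_div, mul_zero]
      by_contra! choose_ne_zero
      simp only [mul_ne_zero_iff, Nat.choose_ne_zero_iff, add_le_add_iff_left] at choose_ne_zero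
      obtain ⟨hmj, hmk⟩ := choose_ne_zero
      exact hq ⟨((j - m, k - m), m), by simp only [shift, Nat.sub_add_cancel, hmj, hmk]⟩
  refine hterm.prod_fiberwise fun q => ?_
  have hinner : HasSum (fun m => term (q, m)) (∑ m ∈ range (q.1 + 1), term (q, m)) :=
    hasSum_sum_of_ne_finset_zero fun m hm => by
      have hm : q.1 < m := by simpa using hm
      simp only [term, Nat.choose_eq_zero_of_lt hm, zero_mul, Nat.cast_zero, zero_div, mul_zero]
  convert hinner using 1
  simp only [term]
  rw [← mul_sum, ← sum_div, ← Nat.cast_sum, sum_choose_mul_choose_add,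
    show n + q.1 + q.2 = q.2 + (n + q.1) by ring, ← Nat.choose_symm_add, Nat.cast_add_choose]
  field_simp

end BesselClifford

section BesselI

/-- The modified Bessel function `I_n(x) = ∑ₖ (x/2)^(2k+n) / (k! (n + k)!)` of the first kind. -/
noncomputable def besselI (n : ℕ) (x : ℝ) : ℝ := (x / 2) ^ n * besselClifford n ((x / 2) ^ 2)

variable (n : ℕ)

lemma besselI_pos {x : ℝ} (hx : 0 < x) : 0 < besselI n x :=
  mul_pos (by positivity) (besselClifford_pos n (sq_nonneg _))

lemma besselI_nonneg {x : ℝ} (hx : 0 ≤ x) : 0 ≤ besselI n x :=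
  mul_nonneg (by positivity) (besselClifford_pos n (sq_nonneg _)).le

@[fun_prop]
lemma measurable_besselI : Measurable (besselI n) := by
  have := measurable_besselClifford n
  unfold besselI
  fun_prop

lemma besselI_le {x : ℝ} (hx : 0 ≤ x) : besselI n x ≤ (x / 2) ^ n / n ! * Real.cosh x :=
  calc besselI n x ≤ (x / 2) ^ n * (Real.cosh x / n !) := by
        unfold besselI; gcongr; exact besselClifford_sq_le n x
    _ = _ := by ring

lemma tendsto_besselI {x : ℝ} (hx : 0 ≤ x) : Tendsto (fun n => besselI n x) atTop (𝓝 0) := by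
  refine squeeze_zero (fun n => besselI_nonneg n hx) (fun n => besselI_le n hx) ?_
  simpa only [zero_mul] using
    (FloorSemiring.tendsto_pow_div_factorial_atTop (x / 2)).mul_const (Real.cosh x)

lemma sum_antidiagonal_factorial_div (r : ℕ) :
    ∑ q ∈ antidiagonal r, ((n + q.1 + q.2)! / (q.1 ! * (n + q.1)! * (q.2 ! * (n + q.2)!)) : ℝ) =
      (2 * (n + r)).choose (n + r + n) / (n + r)! := by
  rw [← Nat.choose_symm_of_eq_add (show 2 * (n + r) = r + (n + r + n) by ring), two_mul,
    Nat.add_choose_eq, Nat.cast_sum, sum_div]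
  refine sum_congr rfl fun q hq => ?_
  obtain rfl := (mem_antidiagonal.1 hq).symm
  rw [show n + (q.1 + q.2) = q.1 + (n + q.2) by ring, Nat.cast_mul, Nat.cast_add_choose,
    show q.1 + (n + q.2) = q.2 + (n + q.1) by ring, Nat.cast_add_choose,
    show n + q.1 + q.2 = q.2 + (n + q.1) by ring]
  field_simp

lemma hasSum_exp_mul_besselI (x : ℝ) :
    HasSum (fun k : ℕ => (x / 2) ^ k / k ! * (2 * k).choose (k + n))
      (Real.exp x * besselI n x) := by
  have hpairs := (hasSum_exp_mul_exp_mul_besselClifford n (x / 2) (x / 2)).mul_left ((x / 2) ^ n)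
  rw [← Real.exp_add, add_halves, mul_left_comm, ← pow_two, ← besselI] at hpairs
  have hdiag := ((HasAntidiagonal.sigmaAntidiagonalEquivProd (A := ℕ)).hasSum_iff.2 hpairs).sigma
    fun r => hasSum_fintype _
  rw [← (add_right_injective n).hasSum_iff]
  · refine hdiag.congr_fun fun r => ?_
    simp only [Function.comp_apply, HasAntidiagonal.sigmaAntidiagonalEquivProd_apply]
    rw [univ_eq_attach, sum_attach (antidiagonal r) fun q : ℕ × ℕ => (x / 2) ^ n * ((x / 2) ^ q.1 *
      (x / 2) ^ q.2 * ((n + q.1 + q.2)! / (q.1 ! * (n + q.1)! * (q.2 ! * (n + q.2)!)) : ℝ)),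
      div_mul_eq_mul_div, mul_div_assoc, ← sum_antidiagonal_factorial_div, mul_sum]
    refine sum_congr rfl fun q hq => ?_
    rw [← (mem_antidiagonal.1 hq : q.1 + q.2 = r)]
    ring
  · intro k hk
    have hk : k < n := by
      by_contra! h
      exact hk ⟨k - n, Nat.add_sub_cancel' h⟩
    rw [Nat.choose_eq_zero_of_lt (by omega), Nat.cast_zero, mul_zero]

lemma choose_two_mul_add_succ_le (k : ℕ) :
    (2 * k).choose (k + (n + 1)) ≤ (2 * k).choose (k + n) := by
  have hsucc := Nat.choose_succ_right_eq (2 * k) (k + n)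
  refine Nat.le_of_mul_le_mul_right (c := k + n + 1) ?_ (by positivity)
  rw [← Nat.add_assoc, hsucc]
  gcongr
  omega

lemma besselI_strictAnti {x : ℝ} (hx : 0 < x) : StrictAnti fun n => besselI n x := by
  refine strictAnti_nat_of_succ_lt fun n => ?_
  rw [← mul_lt_mul_iff_right₀ x.exp_pos]
  refine hasSum_lt (i := n) (fun k => ?_) ?_ (hasSum_exp_mul_besselI (n + 1) x)
    (hasSum_exp_mul_besselI n x)
  · gcongr
    exact choose_two_mul_add_succ_le n k
  · rw [Nat.choose_eq_zero_of_lt (by omega), ← two_mul, Nat.choose_self, Nat.cast_zero, mul_zero]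
    positivity

lemma centralBinom_sq_mul_succ_le (k : ℕ) : k.centralBinom ^ 2 * (k + 1) ≤ 16 ^ k := by
  induction k with
  | zero => simp
  | succ k ih =>
    refine Nat.le_of_mul_le_mul_left (c := (k + 1) ^ 2) ?_ (by positivity)
    calc (k + 1) ^ 2 * ((k + 1).centralBinom ^ 2 * (k + 1 + 1))
        = ((k + 1) * (k + 1).centralBinom) ^ 2 * (k + 2) := by ring
      _ = k.centralBinom ^ 2 * (4 * (2 * k + 1) ^ 2 * (k + 2)) := by
          rw [Nat.succ_mul_centralBinom_succ]; ring
      _ ≤ k.centralBinom ^ 2 * (16 * (k + 1) ^ 3) := Nat.mul_le_mul_left _ (by nlinarith)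
      _ = 16 * (k + 1) ^ 2 * (k.centralBinom ^ 2 * (k + 1)) := by ring
      _ ≤ 16 * (k + 1) ^ 2 * 16 ^ k := by gcongr
      _ = (k + 1) ^ 2 * 16 ^ (k + 1) := by ring

/-- `4⁻ᵏ C(2k, k + n)` is at most `(k + 1)^(-1/2)`; the weight `w` of the AM-GM inequality replaces
this square root by terms whose exponential series has a closed form. -/
lemma two_mul_choose_two_mul_le (k : ℕ) {w : ℝ} (hw : 0 < w) :
    2 * (2 * k).choose (k + n) ≤ 4 ^ k * (w⁻¹ + w / (k + 1 : ℝ)) := by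
  set y : ℝ := (2 * k).choose (k + n) / 4 ^ k
  have y_sq_le : y ^ 2 ≤ 1 / (k + 1) := by
    have centralBinom_bound : (k.centralBinom ^ 2 * (k + 1) : ℝ) ≤ (4 ^ k) ^ 2 := by
      rw [← pow_mul, mul_comm k, pow_mul]
      exact_mod_cast centralBinom_sq_mul_succ_le k
    have choose_le : ((2 * k).choose (k + n) : ℝ) ≤ k.centralBinom :=
      mod_cast Nat.choose_le_centralBinom (k + n) k
    rw [div_pow, div_le_div_iff₀ (by positivity) (by positivity), one_mul]
    exact le_trans (by gcongr) centralBinom_bound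
  calc (2 * (2 * k).choose (k + n) : ℝ) = 4 ^ k * (2 * y) := by simp only [y]; field_simp
    _ ≤ 4 ^ k * (w⁻¹ + w * y ^ 2) := by
        gcongr
        have square_nonneg := mul_nonneg (inv_pos.2 hw).le (sq_nonneg (w * y - 1))
        linear_combination square_nonneg + (w * y ^ 2 - 2 * y) * inv_mul_cancel₀ hw.ne'
    _ ≤ 4 ^ k * (w⁻¹ + w * (1 / (k + 1))) := by gcongr
    _ = _ := by rw [mul_one_div]

lemma hasSum_pow_div_factorial_div_succ {x : ℝ} (hx : x ≠ 0) :
    HasSum (fun k : ℕ => x ^ k / k ! / (k + 1 : ℝ)) ((Real.exp x - 1) / x) := by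
  have := ((hasSum_nat_add_iff' 1).2 (hasSum_pow_div_factorial x)).div_const x
  simp only [range_one, sum_singleton, pow_zero, Nat.factorial_zero, Nat.cast_one, div_one] at this
  refine this.congr_fun fun k => ?_
  rw [Nat.factorial_succ]
  push_cast
  field_simp
  ring

lemma besselI_le_exp_div_sqrt {x : ℝ} (hx : 0 < x) : besselI n x ≤ Real.exp x / √x := by
  have sqrt_pos : 0 < √x := Real.sqrt_pos.2 hx
  have hterms := hasSum_le (fun k => ?_) ((hasSum_exp_mul_besselI n x).mul_left 2)
    (((hasSum_pow_div_factorial (2 * x)).mul_left (√x)⁻¹).add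
      ((hasSum_pow_div_factorial_div_succ (x := 2 * x) (by positivity)).mul_left √x))
  · have sqrt_mul : √x * ((Real.exp (2 * x) - 1) / (2 * x)) ≤ Real.exp (2 * x) / √x := by
      rw [mul_div_assoc', div_le_div_iff₀ (by positivity) sqrt_pos, mul_right_comm,
        Real.mul_self_sqrt hx.le]
      nlinarith [Real.exp_pos (2 * x)]
    rw [two_mul x, Real.exp_add] at hterms sqrt_mul
    rw [← mul_le_mul_iff_right₀ x.exp_pos]
    linear_combination (hterms + sqrt_mul) / 2
  · calc _ = (x / 2) ^ k / k ! * (2 * (2 * k).choose (k + n)) := by ring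
      _ ≤ (x / 2) ^ k / k ! * (4 ^ k * ((√x)⁻¹ + √x / (k + 1 : ℝ))) := by
          gcongr ?_ * ?_
          exact two_mul_choose_two_mul_le n k sqrt_pos
      _ = _ := by rw [show 2 * x = x / 2 * 4 by ring, mul_pow (x / 2)]; ring

end BesselI

section Weber

lemma integrableOn_pow_mul_gaussian (k : ℕ) {p : ℝ} (hp : 0 < p) :
    IntegrableOn (fun t : ℝ => t ^ (2 * k + 1) * Real.exp (-p * t ^ 2)) (Ioi 0) := by
  have hk : (-1 : ℝ) < (2 * k + 1 : ℕ) := by linarith [Nat.cast_nonneg (α := ℝ) (2 * k + 1)]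
  simpa only [Real.rpow_natCast] using integrableOn_rpow_mul_exp_neg_mul_sq hp hk

lemma integral_pow_mul_gaussian (k : ℕ) {p : ℝ} (hp : 0 < p) :
    ∫ t in Ioi (0 : ℝ), t ^ (2 * k + 1) * Real.exp (-p * t ^ 2) = k ! / (2 * p ^ (k + 1)) := by
  have hk : (-1 : ℝ) < (2 * k + 1 : ℕ) := by linarith [Nat.cast_nonneg (α := ℝ) (2 * k + 1)]
  have hgamma := integral_rpow_mul_exp_neg_mul_rpow two_pos hk hp
  have half_exponent : ((2 * k + 1 : ℕ) + 1 : ℝ) / 2 = (k + 1 : ℕ) := by push_cast; ring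
  rw [neg_div, half_exponent, Nat.cast_succ k, Real.Gamma_nat_eq_factorial, ← Nat.cast_succ,
    Real.rpow_neg hp.le] at hgamma
  simp only [Real.rpow_natCast, Real.rpow_two] at hgamma
  rw [hgamma]
  field_simp

lemma integral_gaussian_mul_of_hasSum {ι : Type*} [Countable ι] {p S : ℝ} (hp : 0 < p)
    {A : ι → ℝ} {N : ι → ℕ} {f : ℝ → ℝ} (hf : ∀ t, HasSum (fun i => A i * t ^ (2 * N i)) (f t))
    (hS : HasSum (fun i => A i * ((N i)! / (2 * p ^ (N i + 1)))) S) :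
    ∫ t in Ioi (0 : ℝ), t * Real.exp (-p * t ^ 2) * f t = S := by
  let F : ι → ℝ → ℝ := fun i t => A i * (t ^ (2 * N i + 1) * Real.exp (-p * t ^ 2))
  have integrable_F (i) : Integrable (F i) (volume.restrict (Ioi 0)) :=
    (integrableOn_pow_mul_gaussian _ hp).const_mul _
  have integral_F (i) : ∫ t in Ioi (0 : ℝ), F i t = A i * ((N i)! / (2 * p ^ (N i + 1))) := by
    rw [integral_const_mul, integral_pow_mul_gaussian _ hp]
  have integral_norm_F (i) :
      ∫ t in Ioi (0 : ℝ), ‖F i t‖ = ‖A i * ((N i)! / (2 * p ^ (N i + 1)))‖ := by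
    have norm_F : EqOn (fun t => ‖F i t‖)
        (fun t => ‖A i‖ * (t ^ (2 * N i + 1) * Real.exp (-p * t ^ 2))) (Ioi 0) := fun t ht => by
      have ht : 0 < t := ht
      simp only [F, norm_mul, norm_pow, Real.norm_of_nonneg ht.le,
        Real.norm_of_nonneg (Real.exp_nonneg _)]
    rw [setIntegral_congr_fun measurableSet_Ioi norm_F, integral_const_mul,
      integral_pow_mul_gaussian _ hp, norm_mul,
      Real.norm_of_nonneg (by positivity : (0 : ℝ) ≤ (N i)! / (2 * p ^ (N i + 1)))]
  have hsum := hasSum_integral_of_summable_integral_norm integrable_F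
    (by simpa only [integral_norm_F] using hS.summable.norm)
  simp only [integral_F] at hsum
  rw [← hsum.unique hS]
  congr with t
  rw [← (hf t).tsum_eq, ← tsum_mul_left]
  congr with i
  simp only [F]
  ring

/-- The value of Weber's second exponential integral
`∫₀^∞ t exp (-p t²) J_n(a t) J_n(c t) dt`, in which `n` enters only through the positive function
`I_n`. -/
noncomputable def weberKernel (n : ℕ) (a c p : ℝ) : ℝ :=
  1 / (2 * p) * (Real.exp (-(a ^ 2 + c ^ 2) / (4 * p)) * besselI n (a * c / (2 * p)))

variable (n : ℕ) {a c p : ℝ}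

lemma integral_gaussian_mul_besselJ_mul_besselJ (a c : ℝ) (hp : 0 < p) :
    ∫ t in Ioi (0 : ℝ), t * Real.exp (-p * t ^ 2) * (besselJ n (a * t) * besselJ n (c * t)) =
      weberKernel n a c p := by
  refine integral_gaussian_mul_of_hasSum hp (hasSum_besselJ_mul_besselJ n a c) ?_
  have hseries := (hasSum_exp_mul_exp_mul_besselClifford n (-(a / 2) ^ 2 / p)
    (-(c / 2) ^ 2 / p)).mul_left (1 / (2 * p) * (a * c / 4 / p) ^ n)
  have argument : -(a / 2) ^ 2 / p * (-(c / 2) ^ 2 / p) = (a * c / (2 * p) / 2) ^ 2 := by ring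
  have exponent : -(a / 2) ^ 2 / p + -(c / 2) ^ 2 / p = -(a ^ 2 + c ^ 2) / (4 * p) := by
    field_simp; ring
  have hvalue : 1 / (2 * p) * (a * c / 4 / p) ^ n * (Real.exp (-(a / 2) ^ 2 / p) *
      Real.exp (-(c / 2) ^ 2 / p) * besselClifford n (-(a / 2) ^ 2 / p * (-(c / 2) ^ 2 / p))) =
      weberKernel n a c p := by
    rw [← Real.exp_add, argument, exponent, weberKernel, besselI]
    ring
  rw [hvalue] at hseries
  refine hseries.congr_fun fun q => ?_
  simp only [div_pow _ p, pow_add p]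
  field_simp

@[fun_prop]
lemma measurable_weberKernel (a c : ℝ) : Measurable (weberKernel n a c) := by
  unfold weberKernel
  fun_prop

lemma weberKernel_pos (hac : 0 < a * c) (hp : 0 < p) : 0 < weberKernel n a c p := by
  have := besselI_pos n (x := a * c / (2 * p)) (by positivity)
  unfold weberKernel
  positivity

lemma weberKernel_strictAnti (hac : 0 < a * c) (hp : 0 < p) :
    StrictAnti fun n => weberKernel n a c p := fun m n hmn => by
  have hI : besselI n (a * c / (2 * p)) < besselI m (a * c / (2 * p)) :=
    besselI_strictAnti (by positivity) hmn
  simp only [weberKernel]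
  gcongr

lemma tendsto_weberKernel (hac : 0 ≤ a * c) (hp : 0 ≤ p) :
    Tendsto (fun n => weberKernel n a c p) atTop (𝓝 0) := by
  have hI := tendsto_besselI (x := a * c / (2 * p)) (by positivity)
  simpa only [weberKernel, mul_zero] using
    (hI.const_mul (Real.exp (-(a ^ 2 + c ^ 2) / (4 * p)))).const_mul (1 / (2 * p))

lemma exp_mul_exp_div_le (a c : ℝ) (hp : 0 < p) :
    Real.exp (-(a ^ 2 + c ^ 2) / (4 * p)) * Real.exp (a * c / (2 * p)) ≤ 1 := by
  have square : -(a ^ 2 + c ^ 2) / (4 * p) + a * c / (2 * p) = -((a - c) ^ 2 / (4 * p)) := by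
    field_simp; ring
  rw [← Real.exp_add, Real.exp_le_one_iff, square, neg_nonpos]
  positivity

lemma weberKernel_le_inv_sqrt (hac : 0 < a * c) (hp : 0 < p) :
    weberKernel n a c p ≤ 1 / √(2 * (a * c)) * p ^ (-(1 / 2) : ℝ) :=
  calc weberKernel n a c p
    _ ≤ 1 / (2 * p) * (Real.exp (-(a ^ 2 + c ^ 2) / (4 * p)) *
          (Real.exp (a * c / (2 * p)) / √(a * c / (2 * p)))) := by
        unfold weberKernel
        gcongr
        exact besselI_le_exp_div_sqrt n (by positivity)
    _ ≤ 1 / (2 * p) * (1 / √(a * c / (2 * p))) := by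
        rw [← mul_div_assoc]
        gcongr
        exact exp_mul_exp_div_le a c hp
    _ = _ := by
        have sqrt_eq : 2 * p * √(a * c / (2 * p)) = √(2 * (a * c)) * √p := by
          nth_rw 1 [← Real.sqrt_sq (by positivity : 0 ≤ 2 * p)]
          rw [← Real.sqrt_mul (by positivity), ← Real.sqrt_mul (by positivity)]
          congr 1
          field_simp
        rw [Real.rpow_neg hp.le, ← Real.sqrt_eq_rpow, one_div_mul_one_div, sqrt_eq, ← one_div,
          one_div_mul_one_div]

lemma weberKernel_le_pow (hac : 0 ≤ a * c) (hp : 0 < p) :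
    weberKernel n a c p ≤ (a * c / 4) ^ n / (2 * n !) * p ^ (-(n + 1 : ℝ)) :=
  calc weberKernel n a c p
    _ ≤ 1 / (2 * p) * (Real.exp (-(a ^ 2 + c ^ 2) / (4 * p)) *
          ((a * c / (2 * p) / 2) ^ n / n ! * Real.exp (a * c / (2 * p)))) := by
        have hz : 0 ≤ a * c / (2 * p) := by positivity
        have cosh_le : Real.cosh (a * c / (2 * p)) ≤ Real.exp (a * c / (2 * p)) := by
          rw [← Real.cosh_add_sinh]
          exact le_add_of_nonneg_right (Real.sinh_nonneg_iff.2 hz)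
        unfold weberKernel
        gcongr
        exact (besselI_le n hz).trans (by gcongr)
    _ ≤ 1 / (2 * p) * ((a * c / (2 * p) / 2) ^ n / n ! * 1) := by
        rw [mul_left_comm (Real.exp _)]
        gcongr
        exact exp_mul_exp_div_le a c hp
    _ = _ := by
        rw [Real.rpow_neg hp.le, ← Nat.cast_succ, Real.rpow_natCast, pow_succ,
          show a * c / (2 * p) / 2 = a * c / 4 / p by ring, div_pow _ p]
        field_simp

lemma weberKernel_div_pow_lt {a' c' : ℝ} (hac : 0 < a * c) (hp : 0 < p)
    (hsum : a ^ 2 + c ^ 2 = a' ^ 2 + c' ^ 2) (hprod : a * c < a' * c') :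
    weberKernel n a c p / (a * c) ^ n < weberKernel n a' c' p / (a' * c') ^ n := by
  have div_pow_eq {x y : ℝ} (hxy : 0 < x * y) : weberKernel n x y p / (x * y) ^ n =
      1 / (2 * p) * (Real.exp (-(x ^ 2 + y ^ 2) / (4 * p)) *
        (besselClifford n ((x * y / (2 * p) / 2) ^ 2) / (4 * p) ^ n)) := by
    rw [weberKernel, besselI, div_div, show 2 * p * 2 = 4 * p by ring, div_pow _ _ n]
    field_simp
  rw [div_pow_eq hac, div_pow_eq (hac.trans hprod), hsum]
  have clifford_lt : besselClifford n ((a * c / (2 * p) / 2) ^ 2) <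
      besselClifford n ((a' * c' / (2 * p) / 2) ^ 2) :=
    besselClifford_strictMonoOn n (mem_Ici.2 (sq_nonneg _)) (mem_Ici.2 (sq_nonneg _)) (by gcongr)
  gcongr

end Weber

lemma setIntegral_lt_setIntegral {X : Type*} [MeasurableSpace X] {μ : Measure X} {s : Set X}
    {f g : X → ℝ} (hs : MeasurableSet s) (hμs : μ s ≠ 0) (hf : IntegrableOn f s μ)
    (hg : IntegrableOn g s μ) (hfg : ∀ x ∈ s, f x < g x) :
    ∫ x in s, f x ∂μ < ∫ x in s, g x ∂μ := by
  rw [← sub_pos, ← integral_sub hg hf, setIntegral_pos_iff_support_of_nonneg_ae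
    (ae_restrict_of_forall_mem hs fun x hx => (sub_pos.2 (hfg x hx)).le) (hg.sub hf),
    inter_eq_right.2 fun x hx => Function.mem_support.2 (sub_pos.2 (hfg x hx)).ne']
  exact pos_iff_ne_zero.2 hμs

lemma neg_two_mul_lt_of_le {α : ℝ} {m n : ℕ} (hαm : -(2 * m) < α) (hmn : m ≤ n) :
    -(2 * n) < α :=
  lt_of_le_of_lt (by gcongr) hαm

section WeberSchafheitlin

/-- The critical Weber–Schafheitlin integral `∫₀^∞ J_n(a t) J_n(c t) t^(α - 1) dt`. -/
noncomputable def weberSchafheitlin (α : ℝ) (n : ℕ) (a c : ℝ) : ℝ :=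
  ∫ t in Ioi (0 : ℝ), besselJ n (a * t) * besselJ n (c * t) / t ^ (1 - α)

variable {α a c : ℝ} {n : ℕ}

lemma integrableOn_rpow_mul_weberKernel (hαn : -(2 * n) < α) (hα : α < 1) (hac : 0 < a * c) :
    IntegrableOn (fun p => p ^ (-(α / 2)) * weberKernel n a c p) (Ioi 0) := by
  rw [← Ioc_union_Ioi_eq_Ioi zero_le_one]
  refine IntegrableOn.union ?_ ?_
  · have hpow : IntegrableOn (fun p : ℝ => p ^ (-(α / 2) + -(1 / 2))) (Ioc 0 1) := by
      rw [← intervalIntegrable_iff_integrableOn_Ioc_of_le zero_le_one]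
      exact intervalIntegral.intervalIntegrable_rpow' (by linarith)
    refine (hpow.const_mul (1 / √(2 * (a * c)))).mono' (by fun_prop)
      (ae_restrict_of_forall_mem measurableSet_Ioc fun p hp => ?_)
    have hp : 0 < p := hp.1
    have := weberKernel_pos n hac hp
    rw [Real.norm_of_nonneg (by positivity), Real.rpow_add hp, mul_left_comm]
    gcongr
    exact weberKernel_le_inv_sqrt n hac hp
  · have hpow := integrableOn_Ioi_rpow_of_lt (a := -(α / 2) + -(n + 1)) (by linarith) one_pos
    refine (hpow.const_mul ((a * c / 4) ^ n / (2 * n !))).mono' (by fun_prop)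
      (ae_restrict_of_forall_mem measurableSet_Ioi fun p hp => ?_)
    have hp : 0 < p := zero_lt_one.trans hp
    have := weberKernel_pos n hac hp
    rw [Real.norm_of_nonneg (by positivity), Real.rpow_add hp, mul_left_comm]
    gcongr
    exact weberKernel_le_pow n hac.le hp

/-- The integrand of a double integral over `t, p > 0`: integrating out `p` leaves `Γ(1 - α/2)`
times the integrand of `weberSchafheitlin`, and integrating out `t` leaves
`p^(-α/2) * weberKernel n a c p`. -/
noncomputable def gaussianBessel (α : ℝ) (n : ℕ) (a c t p : ℝ) : ℝ :=
  p ^ (-(α / 2)) * (t * Real.exp (-p * t ^ 2) * (besselJ n (a * t) * besselJ n (c * t)))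

lemma measurable_gaussianBessel : Measurable (Function.uncurry (gaussianBessel α n a c)) := by
  unfold gaussianBessel Function.uncurry
  fun_prop

lemma integral_gaussianBessel_fst {p : ℝ} (hp : 0 < p) :
    ∫ t in Ioi 0, gaussianBessel α n a c t p = p ^ (-(α / 2)) * weberKernel n a c p := by
  unfold gaussianBessel
  rw [integral_const_mul, integral_gaussian_mul_besselJ_mul_besselJ n a c hp]

lemma integral_gaussianBessel_snd (hα : α < 2) {t : ℝ} (ht : 0 < t) :
    ∫ p in Ioi 0, gaussianBessel α n a c t p =
      Real.Gamma (1 - α / 2) * (besselJ n (a * t) * besselJ n (c * t) / t ^ (1 - α)) := by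
  have hgamma := Real.integral_rpow_mul_exp_neg_mul_Ioi (a := 1 - α / 2) (r := t ^ 2)
    (by linarith) (by positivity)
  have hpow : t * (1 / t ^ 2) ^ (1 - α / 2) = (t ^ (1 - α))⁻¹ := by
    rw [one_div, ← Real.rpow_two, ← Real.rpow_neg ht.le, ← Real.rpow_mul ht.le,
      ← Real.rpow_neg ht.le]
    nth_rw 1 [← Real.rpow_one t]
    rw [← Real.rpow_add ht]
    congr 1
    ring
  calc ∫ p in Ioi 0, gaussianBessel α n a c t p
      = ∫ p in Ioi 0, t * (besselJ n (a * t) * besselJ n (c * t)) *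
          (p ^ (1 - α / 2 - 1) * Real.exp (-(t ^ 2 * p))) := by
        congr with p
        rw [gaussianBessel, sub_sub_cancel_left, neg_mul, mul_comm p]
        ring
    _ = t * (1 / t ^ 2) ^ (1 - α / 2) * Real.Gamma (1 - α / 2) *
          (besselJ n (a * t) * besselJ n (c * t)) := by
        rw [integral_const_mul, hgamma]; ring
    _ = _ := by rw [hpow]; ring

lemma integrable_gaussianBessel_self (hαn : -(2 * n) < α) (hα : α < 1) (ha : a ≠ 0) :
    Integrable (Function.uncurry (gaussianBessel α n a a))
      ((volume.restrict (Ioi 0)).prod (volume.restrict (Ioi 0))) := by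
  have ha : 0 < a * a := mul_self_pos.2 ha
  rw [integrable_prod_iff' measurable_gaussianBessel.aestronglyMeasurable]
  constructor
  · refine ae_restrict_of_forall_mem measurableSet_Ioi fun p hp => .of_integral_ne_zero ?_
    have hp : 0 < p := hp
    have := weberKernel_pos n ha hp
    simp only [Function.uncurry_apply_pair, integral_gaussianBessel_fst hp]
    positivity
  · refine (integrableOn_rpow_mul_weberKernel hαn hα ha).congr_fun (fun p hp => ?_)
      measurableSet_Ioi
    have hp : 0 < p := hp
    have gaussianBessel_nonneg : ∀ t ∈ Ioi (0 : ℝ), 0 ≤ gaussianBessel α n a a t p :=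
      fun t ht => by
        have ht : 0 < t := ht
        have := mul_self_nonneg (besselJ n (a * t))
        unfold gaussianBessel
        positivity
    dsimp only
    rw [← integral_gaussianBessel_fst hp]
    exact setIntegral_congr_fun measurableSet_Ioi fun t ht =>
      (Real.norm_of_nonneg (gaussianBessel_nonneg t ht)).symm

lemma integrable_gaussianBessel (hαn : -(2 * n) < α) (hα : α < 1) (hac : 0 < a * c) :
    Integrable (Function.uncurry (gaussianBessel α n a c))
      ((volume.restrict (Ioi 0)).prod (volume.restrict (Ioi 0))) := by
  refine ((integrable_gaussianBessel_self hαn hα (left_ne_zero_of_mul hac.ne')).add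
    (integrable_gaussianBessel_self hαn hα (right_ne_zero_of_mul hac.ne'))).mono'
      measurable_gaussianBessel.aestronglyMeasurable ?_
  rw [Measure.prod_restrict]
  refine ae_restrict_of_forall_mem (measurableSet_Ioi.prod measurableSet_Ioi) ?_
  rintro ⟨t, p⟩ ⟨ht, hp⟩
  have ht : 0 < t := ht
  have hp : 0 < p := hp
  -- This reduces absolute convergence to `a = c`, where the integrand is nonnegative.
  have abs_le (x y : ℝ) : |x * y| ≤ x * x + y * y := by
    rw [abs_mul]
    nlinarith [two_mul_le_add_sq |x| |y|, sq_abs x, sq_abs y, sq_nonneg x, sq_nonneg y]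
  simp only [Function.uncurry_apply_pair, Pi.add_apply, gaussianBessel]
  rw [norm_mul, norm_mul _ (besselJ n _ * _),
    Real.norm_of_nonneg (by positivity : 0 ≤ p ^ (-(α / 2))),
    Real.norm_of_nonneg (by positivity : 0 ≤ t * Real.exp (-p * t ^ 2)), ← mul_add, ← mul_add]
  gcongr
  exact abs_le _ _

lemma weberSchafheitlin_eq (hαn : -(2 * n) < α) (hα : α < 1) (hac : 0 < a * c) :
    weberSchafheitlin α n a c =
      (Real.Gamma (1 - α / 2))⁻¹ * ∫ p in Ioi 0, p ^ (-(α / 2)) * weberKernel n a c p := by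
  rw [eq_inv_mul_iff_mul_eq₀ (Real.Gamma_pos_of_pos (by linarith)).ne', weberSchafheitlin,
    ← integral_const_mul]
  calc ∫ t in Ioi 0, Real.Gamma (1 - α / 2) * (besselJ n (a * t) * besselJ n (c * t) / t ^ (1 - α))
      = ∫ t in Ioi 0, ∫ p in Ioi 0, gaussianBessel α n a c t p :=
        setIntegral_congr_fun measurableSet_Ioi fun t ht =>
          (integral_gaussianBessel_snd (hα.trans one_lt_two) ht).symm
    _ = ∫ p in Ioi 0, ∫ t in Ioi 0, gaussianBessel α n a c t p :=
        integral_integral_swap (integrable_gaussianBessel hαn hα hac)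
    _ = _ := setIntegral_congr_fun measurableSet_Ioi fun p hp => integral_gaussianBessel_fst hp

lemma weberSchafheitlin_mul_mul {r : ℝ} (hr : 0 < r) (α : ℝ) (n : ℕ) (a c : ℝ) :
    weberSchafheitlin α n (r * a) (r * c) = r ^ (-α) * weberSchafheitlin α n a c := by
  have hscale := integral_comp_mul_left_Ioi
    (fun t => besselJ n (a * t) * besselJ n (c * t) / t ^ (1 - α)) 0 hr
  have hpow : r ^ (-α) = r ^ (1 - α) * r⁻¹ := by
    rw [← div_eq_mul_inv, ← Real.rpow_sub_one hr.ne', sub_sub_cancel_left]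
  rw [mul_zero, smul_eq_mul, ← weberSchafheitlin] at hscale
  rw [hpow, mul_assoc, ← hscale, ← integral_const_mul, weberSchafheitlin]
  refine setIntegral_congr_fun measurableSet_Ioi fun t ht => ?_
  have ht : 0 < t := ht
  simp only [Real.mul_rpow hr.le ht.le, mul_assoc, mul_left_comm r]
  field_simp

lemma weberSchafheitlin_pos (hαn : -(2 * n) < α) (hα : α < 1) (hac : 0 < a * c) :
    0 < weberSchafheitlin α n a c := by
  have hΓ : 0 < Real.Gamma (1 - α / 2) := Real.Gamma_pos_of_pos (by linarith)
  rw [weberSchafheitlin_eq hαn hα hac]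
  refine mul_pos (inv_pos.2 hΓ) ?_
  simpa only [integral_zero] using setIntegral_lt_setIntegral measurableSet_Ioi (by simp)
    integrableOn_zero (integrableOn_rpow_mul_weberKernel hαn hα hac) fun p hp =>
      mul_pos (Real.rpow_pos_of_pos hp _) (weberKernel_pos n hac hp)

lemma weberSchafheitlin_lt {m : ℕ} (hαm : -(2 * m) < α) (hα : α < 1) (hac : 0 < a * c)
    (hmn : m < n) : weberSchafheitlin α n a c < weberSchafheitlin α m a c := by
  have hΓ : 0 < Real.Gamma (1 - α / 2) := Real.Gamma_pos_of_pos (by linarith)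
  have hαn : -(2 * n) < α := neg_two_mul_lt_of_le hαm hmn.le
  rw [weberSchafheitlin_eq hαn hα hac, weberSchafheitlin_eq hαm hα hac]
  gcongr
  refine setIntegral_lt_setIntegral measurableSet_Ioi (by simp)
    (integrableOn_rpow_mul_weberKernel hαn hα hac)
    (integrableOn_rpow_mul_weberKernel hαm hα hac) fun p hp => ?_
  have hp : 0 < p := hp
  have := weberKernel_strictAnti hac hp hmn
  gcongr

lemma weberSchafheitlin_div_pow_lt {a' c' : ℝ} (hαn : -(2 * n) < α) (hα : α < 1)
    (hac : 0 < a * c) (hsum : a ^ 2 + c ^ 2 = a' ^ 2 + c' ^ 2) (hprod : a * c < a' * c') :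
    weberSchafheitlin α n a c / (a * c) ^ n < weberSchafheitlin α n a' c' / (a' * c') ^ n := by
  have hΓ : 0 < Real.Gamma (1 - α / 2) := Real.Gamma_pos_of_pos (by linarith)
  have hac' := hac.trans hprod
  rw [weberSchafheitlin_eq hαn hα hac, weberSchafheitlin_eq hαn hα hac', mul_div_assoc,
    mul_div_assoc, ← integral_div, ← integral_div]
  gcongr
  refine setIntegral_lt_setIntegral measurableSet_Ioi (by simp)
    ((integrableOn_rpow_mul_weberKernel hαn hα hac).div_const _)
    ((integrableOn_rpow_mul_weberKernel hαn hα hac').div_const _) fun p hp => ?_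
  have hp : 0 < p := hp
  have := weberKernel_div_pow_lt n hac hp hsum hprod
  rw [mul_div_assoc, mul_div_assoc]
  gcongr

lemma tendsto_weberSchafheitlin (hα : α < 1) (hac : 0 < a * c) :
    Tendsto (fun n => weberSchafheitlin α n a c) atTop (𝓝 0) := by
  obtain ⟨m, hm⟩ := exists_nat_gt (-(α / 2))
  have hαm : -(2 * m) < α := by linarith
  have hlim : Tendsto (fun n => (Real.Gamma (1 - α / 2))⁻¹ *
      ∫ p in Ioi 0, p ^ (-(α / 2)) * weberKernel n a c p) atTop (𝓝 0) := by
    have hdom := tendsto_integral_filter_of_dominated_convergence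
      (μ := volume.restrict (Ioi 0)) (l := atTop) (f := fun _ => (0 : ℝ))
      (F := fun n p => p ^ (-(α / 2)) * weberKernel n a c p)
      (fun p => p ^ (-(α / 2)) * weberKernel m a c p)
      (.of_forall fun n => by fun_prop) ?_
      (integrableOn_rpow_mul_weberKernel hαm hα hac) ?_
    · simpa only [integral_zero, mul_zero] using hdom.const_mul (Real.Gamma (1 - α / 2))⁻¹
    · filter_upwards [eventually_ge_atTop m] with n hn
      refine ae_restrict_of_forall_mem measurableSet_Ioi fun p hp => ?_
      have hp : 0 < p := hp
      have := weberKernel_pos n hac hp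
      rw [Real.norm_of_nonneg (by positivity)]
      gcongr
      exact (weberKernel_strictAnti hac hp).antitone hn
    · refine ae_restrict_of_forall_mem measurableSet_Ioi fun p hp => ?_
      simpa only [mul_zero] using (tendsto_weberKernel hac.le (le_of_lt hp)).const_mul _
  refine hlim.congr' ?_
  filter_upwards [eventually_ge_atTop m] with n hn
  rw [weberSchafheitlin_eq (neg_two_mul_lt_of_le hαm hn) hα hac]

end WeberSchafheitlin

lemma two_mul_sqrt_rpow_neg_le {α b : ℝ} (hα : 0 ≤ α) (hb : 0 < b) :
    2 * √((1 + b ^ 2) / 2) ^ (-α) ≤ b ^ (-α) + 1 := by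
  have h_sqrt_le : √b ≤ √((1 + b ^ 2) / 2) :=
    Real.sqrt_le_sqrt (by linarith [two_mul_le_add_sq 1 b])
  have h_sq : (√b ^ (-α)) ^ 2 = b ^ (-α) := by
    rw [← Real.rpow_mul_natCast (Real.sqrt_nonneg b), mul_comm, Real.rpow_mul (Real.sqrt_nonneg b),
      Real.rpow_natCast, Real.sq_sqrt hb.le]
  calc 2 * √((1 + b ^ 2) / 2) ^ (-α)
      ≤ 2 * √b ^ (-α) := by
        gcongr ?_ * ?_
        exact Real.rpow_le_rpow_of_nonpos (Real.sqrt_pos.2 hb) h_sqrt_le (neg_nonpos.2 hα)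
    _ ≤ (√b ^ (-α)) ^ 2 + 1 := by linarith [two_mul_le_add_sq (√b ^ (-α)) 1]
    _ = b ^ (-α) + 1 := by rw [h_sq]

section Lam

variable {α b : ℝ} {n : ℕ}

lemma Lam_eq (α : ℝ) (n : ℕ) (b : ℝ) : Lam α n b = 1 / b * weberSchafheitlin α n b 1 := by
  simp only [Lam, weberSchafheitlin, one_mul]

lemma Lam_pos (hαn : -(2 * n) < α) (hα : α < 1) (hb : 0 < b) : 0 < Lam α n b := by
  have hW : 0 < weberSchafheitlin α n b 1 := weberSchafheitlin_pos hαn hα (by simpa)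
  rw [Lam_eq]
  positivity

lemma Lam_strictAntiOn (hα : α < 1) (hb : 0 < b) :
    StrictAntiOn (fun n : ℕ => Lam α n b) {n | -(2 * n) < α} := fun m hm n _ hmn => by
  have hW : weberSchafheitlin α n b 1 < weberSchafheitlin α m b 1 :=
    weberSchafheitlin_lt hm hα (by simpa) hmn
  simp only [Lam_eq]
  gcongr

lemma tendsto_Lam (hα : α < 1) (hb : 0 < b) : Tendsto (fun n => Lam α n b) atTop (𝓝 0) := by
  simpa [Lam_eq] using (tendsto_weberSchafheitlin hα (by simpa : 0 < b * 1)).const_mul (1 / b)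

lemma one_add_sq_mul_Lam_one_lt (hα0 : 0 ≤ α) (hα1 : α < 1) (hb : 0 < b) (hb1 : b ≠ 1) :
    (1 + b ^ 2) * Lam α 1 b < (b ^ (-α) + 1) * Lam α 1 1 := by
  have hα2 : -(2 * (1 : ℕ)) < α := by push_cast; linarith
  set d := √((1 + b ^ 2) / 2)
  have hd0 : 0 < d := Real.sqrt_pos.2 (by positivity)
  have hd_sq : d ^ 2 = (1 + b ^ 2) / 2 := Real.sq_sqrt (by positivity)
  have h_prod : b * 1 < d * d := by nlinarith [sq_pos_of_ne_zero (sub_ne_zero.2 hb1)]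
  have h_diag : weberSchafheitlin α 1 d d = d ^ (-α) * Lam α 1 1 := by
    simpa [Lam_eq] using weberSchafheitlin_mul_mul hd0 α 1 1 1
  have h_compare : Lam α 1 b < d ^ (-α) * Lam α 1 1 / (d * d) := by
    have h := weberSchafheitlin_div_pow_lt (n := 1) hα2 hα1 (by simpa) (by linarith) h_prod
    rwa [h_diag, pow_one, pow_one, mul_one, div_eq_inv_mul, ← one_div, ← Lam_eq] at h
  calc (1 + b ^ 2) * Lam α 1 b = 2 * (Lam α 1 b * (d * d)) := by rw [← sq, hd_sq]; ring
    _ < 2 * (d ^ (-α) * Lam α 1 1) :=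
      mul_lt_mul_of_pos_left ((lt_div_iff₀ (by positivity)).1 h_compare) two_pos
    _ = 2 * d ^ (-α) * Lam α 1 1 := by ring
    _ ≤ (b ^ (-α) + 1) * Lam α 1 1 := by
      have := Lam_pos (n := 1) hα2 hα1 one_pos
      gcongr
      exact two_mul_sqrt_rpow_neg_le hα0 hb

end Lam

section Spectrum

variable {α b : ℝ} {m n : ℕ}

/-- The quantity `(b^(-α) + 1) Θ_n - (1 + b²) Λ_1(b)` whose square is the leading part of `Δ_n`;
the threshold condition compares it with `2 b Λ_n(b)`. -/
noncomputable def diagonalGap (α b : ℝ) (n : ℕ) : ℝ :=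
  (b ^ (-α) + 1) * Theta α n - (1 + b ^ 2) * Lam α 1 b

lemma Delta_eq_sq_sub_sq (α b : ℝ) (n : ℕ) :
    Delta α b n = diagonalGap α b n ^ 2 - (2 * b * Lam α n b) ^ 2 := by
  rw [Delta, diagonalGap]
  ring

lemma diagonalGap_sub (α b : ℝ) (n m : ℕ) :
    diagonalGap α b m - diagonalGap α b n = (b ^ (-α) + 1) * (Theta α m - Theta α n) := by
  simp only [diagonalGap]
  ring

lemma four_mul_det_M (hb : 0 < b) (α Ω : ℝ) (n : ℕ) :
    4 * (M α b Ω n).det = b * ((1 - 2 * Ω - C α b n) ^ 2 - Delta α b n) := by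
  have hpow : b ^ (1 - α) = b * b ^ (-α) := by
    rw [sub_eq_add_neg, Real.rpow_add hb, Real.rpow_one]
  rw [M, Matrix.det_fin_two_of, C, Delta, hpow]
  ring

lemma det_M_eq_zero_iff (hb : 0 < b) (hΔ : 0 ≤ Delta α b n) (Ω : ℝ) :
    (M α b Ω n).det = 0 ↔ 1 - 2 * Ω = lamMinus α b n ∨ 1 - 2 * Ω = lamPlus α b n := by
  have h_factor : 4 * (M α b Ω n).det =
      b * ((1 - 2 * Ω - lamMinus α b n) * (1 - 2 * Ω - lamPlus α b n)) := by
    rw [four_mul_det_M hb, ← Real.sq_sqrt hΔ, lamMinus, lamPlus]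
    ring
  rw [← mul_eq_zero_iff_left four_ne_zero, h_factor, mul_eq_zero_iff_left hb.ne', mul_eq_zero,
    sub_eq_zero, sub_eq_zero]

lemma Theta_strictMonoOn (hα : α < 1) : StrictMonoOn (Theta α) {n | -(2 * n) < α} :=
  fun _ hm _ hn hmn => sub_lt_sub_left (Lam_strictAntiOn hα one_pos hm hn hmn) _

lemma threshold_iff (hb : 0 < b) : Threshold α b n ↔ 2 * b * Lam α n b ≤ diagonalGap α b n := by
  rw [Threshold, div_mul_eq_mul_div, div_mul_eq_mul_div, ← add_div,
    div_le_iff₀ (by positivity : 0 < b ^ (-α) + 1), mul_comm (Theta α n), diagonalGap,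
    le_sub_iff_add_le']

lemma eventually_threshold (hα0 : 0 ≤ α) (hα1 : α < 1) (hb : 0 < b) (hb1 : b ≠ 1) :
    ∀ᶠ n in atTop, Threshold α b n := by
  have h_gap : Tendsto (diagonalGap α b) atTop
      (𝓝 ((b ^ (-α) + 1) * (Lam α 1 1 - 0) - (1 + b ^ 2) * Lam α 1 b)) :=
    (((tendsto_Lam hα1 one_pos).const_sub _).const_mul _).sub_const _
  have h_coupling : Tendsto (fun n => 2 * b * Lam α n b) atTop (𝓝 (2 * b * 0)) :=
    (tendsto_Lam hα1 hb).const_mul _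
  have h_limits : 2 * b * 0 < (b ^ (-α) + 1) * (Lam α 1 1 - 0) - (1 + b ^ 2) * Lam α 1 b := by
    linarith [one_add_sq_mul_Lam_one_lt hα0 hα1 hb hb1]
  filter_upwards [h_coupling.eventually_lt h_gap h_limits] with n hn
  exact (threshold_iff hb).2 hn.le

lemma sqrt_sq_sub_sq_add_le {x y y' d : ℝ} (hy' : 0 ≤ y') (hyy' : y' ≤ y) (hyx : y ≤ x)
    (hd : 0 ≤ d) : √(x ^ 2 - y ^ 2) + d ≤ √((x + d) ^ 2 - y' ^ 2) := by
  have hx : 0 ≤ x := hy'.trans (hyy'.trans hyx)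
  have h_sqrt_le : √(x ^ 2 - y ^ 2) ≤ x :=
    (Real.sqrt_le_left hx).2 (sub_le_self _ (sq_nonneg y))
  have h_sq : √(x ^ 2 - y ^ 2) ^ 2 = x ^ 2 - y ^ 2 :=
    Real.sq_sqrt (sub_nonneg.2 (by gcongr; exact hy'.trans hyy'))
  refine Real.le_sqrt_of_sq_le ?_
  calc (√(x ^ 2 - y ^ 2) + d) ^ 2
      = x ^ 2 - y ^ 2 + 2 * √(x ^ 2 - y ^ 2) * d + d ^ 2 := by rw [add_sq, h_sq]
    _ ≤ x ^ 2 - y' ^ 2 + 2 * x * d + d ^ 2 := by gcongr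
    _ = (x + d) ^ 2 - y' ^ 2 := by ring

namespace Threshold

variable {N : ℕ}

lemma mono (hα : α < 1) (hb : 0 < b) (hαn : -(2 * n) < α) (hnm : n ≤ m) (h : Threshold α b n) :
    Threshold α b m := by
  have hαm : -(2 * m) < α := neg_two_mul_lt_of_le hαn hnm
  rw [threshold_iff hb] at h ⊢
  have hΛ : Lam α m b ≤ Lam α n b := (Lam_strictAntiOn hα hb).antitoneOn hαn hαm hnm
  have hΘ : Theta α n ≤ Theta α m := (Theta_strictMonoOn hα).monotoneOn hαn hαm hnm
  calc 2 * b * Lam α m b ≤ 2 * b * Lam α n b := by gcongr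
    _ ≤ diagonalGap α b n := h
    _ ≤ diagonalGap α b m := by
      rw [diagonalGap, diagonalGap]
      gcongr

lemma Delta_nonneg (hα : α < 1) (hb : 0 < b) (hαn : -(2 * n) < α) (h : Threshold α b n) :
    0 ≤ Delta α b n := by
  have hΛ : 0 < Lam α n b := Lam_pos hαn hα hb
  have h_le := (threshold_iff hb).1 h
  rw [Delta_eq_sq_sub_sq, sub_nonneg]
  gcongr

lemma sqrt_Delta_add_le (hα : α < 1) (hb : 0 < b) (hαn : -(2 * n) < α) (hnm : n ≤ m)
    (h : Threshold α b n) :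
    √(Delta α b n) + (b ^ (-α) + 1) * (Theta α m - Theta α n) ≤ √(Delta α b m) := by
  have hαm : -(2 * m) < α := neg_two_mul_lt_of_le hαn hnm
  have hΛm : 0 < Lam α m b := Lam_pos hαm hα hb
  have hΛ : Lam α m b ≤ Lam α n b := (Lam_strictAntiOn hα hb).antitoneOn hαn hαm hnm
  have hΘ : Theta α n ≤ Theta α m := (Theta_strictMonoOn hα).monotoneOn hαn hαm hnm
  have h_incr : 0 ≤ diagonalGap α b m - diagonalGap α b n := by
    rw [diagonalGap_sub]
    exact mul_nonneg (by positivity) (sub_nonneg.2 hΘ)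
  have h_sqrt := sqrt_sq_sub_sq_add_le (by positivity : 0 ≤ 2 * b * Lam α m b)
    (by gcongr : 2 * b * Lam α m b ≤ 2 * b * Lam α n b) ((threshold_iff hb).1 h) h_incr
  rwa [add_sub_cancel, ← Delta_eq_sq_sub_sq, ← Delta_eq_sq_sub_sq, diagonalGap_sub] at h_sqrt

lemma abs_C_sub_C_lt (hα : α < 1) (hb : 0 < b) (hαn : -(2 * n) < α) (hnm : n < m)
    (h : Threshold α b n) : |C α b m - C α b n| < √(Delta α b m) - √(Delta α b n) := by
  have hΘ : 0 < Theta α m - Theta α n :=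
    sub_pos.2 (Theta_strictMonoOn hα hαn (neg_two_mul_lt_of_le hαn hnm.le) hnm)
  have hC : C α b m - C α b n = (b ^ (-α) - 1) * (Theta α m - Theta α n) := by
    rw [C, C]
    ring
  have h_abs : |b ^ (-α) - 1| < b ^ (-α) + 1 := by
    have : 0 < b ^ (-α) := by positivity
    rw [abs_lt]
    constructor <;> linarith
  calc |C α b m - C α b n| = |b ^ (-α) - 1| * (Theta α m - Theta α n) := by
        rw [hC, abs_mul, abs_of_pos hΘ]
    _ < (b ^ (-α) + 1) * (Theta α m - Theta α n) := by gcongr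
    _ ≤ √(Delta α b m) - √(Delta α b n) := by linarith [h.sqrt_Delta_add_le hα hb hαn hnm.le]

lemma Delta_strictMonoOn (hα : α < 1) (hb : 0 < b) (hαN : -(2 * N) < α) (h : Threshold α b N) :
    StrictMonoOn (Delta α b) (Ici N) := fun n hn m _ hnm => by
  have hαn : -(2 * n) < α := neg_two_mul_lt_of_le hαN hn
  have h' : Threshold α b n := h.mono hα hb hαN hn
  refine (Real.sqrt_lt_sqrt_iff (h'.Delta_nonneg hα hb hαn)).1 (sub_pos.1 ?_)
  exact (abs_nonneg _).trans_lt (h'.abs_C_sub_C_lt hα hb hαn hnm)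

lemma lamPlus_strictMonoOn (hα : α < 1) (hb : 0 < b) (hαN : -(2 * N) < α)
    (h : Threshold α b N) : StrictMonoOn (lamPlus α b) (Ici N) := fun n hn m _ hnm => by
  have h_abs := (h.mono hα hb hαN hn).abs_C_sub_C_lt hα hb (neg_two_mul_lt_of_le hαN hn) hnm
  rw [lamPlus, lamPlus]
  linarith [neg_lt_of_abs_lt h_abs]

lemma lamMinus_strictAntiOn (hα : α < 1) (hb : 0 < b) (hαN : -(2 * N) < α)
    (h : Threshold α b N) : StrictAntiOn (lamMinus α b) (Ici N) := fun n hn m _ hnm => by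
  have h_abs := (h.mono hα hb hαN hn).abs_C_sub_C_lt hα hb (neg_two_mul_lt_of_le hαN hn) hnm
  rw [lamMinus, lamMinus]
  linarith [lt_of_abs_lt h_abs]

end Threshold

lemma lamMinus_lt_lamPlus (hΔ : 0 < Delta α b n) : lamMinus α b n < lamPlus α b n := by
  rw [lamMinus, lamPlus]
  linarith [Real.sqrt_pos.2 hΔ]

end Spectrum

end GSQG

theorem mainTheorem3_general (α b : ℝ) (hα0 : 0 ≤ α) (hα1 : α < 1) (hb0 : 0 < b) (hb1 : b ≠ 1) :
    ∃ N : ℕ, 2 ≤ N ∧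
      IsLeast {n : ℕ | 2 ≤ n ∧ GSQG.Threshold α b n} N ∧
      0 ≤ GSQG.Delta α b N ∧
      (∀ n : ℕ, N < n →
        0 < GSQG.Delta α b n ∧
        GSQG.lamMinus α b n ≠ GSQG.lamPlus α b n ∧
        ∀ Ω : ℝ, (GSQG.M α b Ω n).det = 0 ↔
          1 - 2 * Ω = GSQG.lamMinus α b n ∨ 1 - 2 * Ω = GSQG.lamPlus α b n) ∧
      StrictMonoOn (GSQG.Delta α b) (Set.Ici N) ∧
      StrictMonoOn (GSQG.lamPlus α b) (Set.Ici N) ∧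
      StrictAntiOn (GSQG.lamMinus α b) (Set.Ici N) ∧
      (∀ m n : ℕ, N < n → n < m →
        GSQG.lamMinus α b m < GSQG.lamMinus α b n ∧
        GSQG.lamMinus α b n < GSQG.lamPlus α b n ∧
        GSQG.lamPlus α b n < GSQG.lamPlus α b m) := by
  classical
  have h_exists : ∃ n : ℕ, 2 ≤ n ∧ GSQG.Threshold α b n :=
    ((Filter.eventually_ge_atTop 2).and (GSQG.eventually_threshold hα0 hα1 hb0 hb1)).exists
  obtain ⟨hN2, hN⟩ := Nat.find_spec h_exists
  have h_least : IsLeast {n | 2 ≤ n ∧ GSQG.Threshold α b n} (Nat.find h_exists) :=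
    ⟨⟨hN2, hN⟩, fun _ hn => Nat.find_min' h_exists hn⟩
  generalize Nat.find h_exists = N at hN2 hN h_least
  have hαN : -(2 * N) < α := by
    have : (2 : ℝ) ≤ N := mod_cast hN2
    linarith
  have hΔN := hN.Delta_nonneg hα1 hb0 hαN
  have hΔ := hN.Delta_strictMonoOn hα1 hb0 hαN
  have h_plus := hN.lamPlus_strictMonoOn hα1 hb0 hαN
  have h_minus := hN.lamMinus_strictAntiOn hα1 hb0 hαN
  have hΔ_pos (n : ℕ) (hn : N < n) : 0 < GSQG.Delta α b n :=
    hΔN.trans_lt (hΔ Set.self_mem_Ici hn.le hn)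
  exact ⟨N, hN2, h_least, hΔN, fun n hn => ⟨hΔ_pos n hn,
    (GSQG.lamMinus_lt_lamPlus (hΔ_pos n hn)).ne, GSQG.det_M_eq_zero_iff hb0 (hΔ_pos n hn).le⟩,
    hΔ, h_plus, h_minus, fun m n hn hnm => ⟨h_minus hn.le (hn.trans hnm).le hnm,
      GSQG.lamMinus_lt_lamPlus (hΔ_pos n hn), h_plus hn.le (hn.trans hnm).le hnm⟩⟩

theorem mainTheorem3 (α b : ℝ) (hα0 : 0 ≤ α) (hα1 : α < 1) (hb0 : 0 < b) (hb1 : b < 1) :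
    ∃ N : ℕ, 2 ≤ N ∧
      -- the value of the threshold, and reality of the sequences from `N` on
      IsLeast {n : ℕ | 2 ≤ n ∧ GSQG.Threshold α b n} N ∧
      0 ≤ GSQG.Delta α b N ∧
      -- positive discriminant and exactly two distinct real solutions, in `λ = 1 - 2Ω`
      (∀ n : ℕ, N < n →
        0 < GSQG.Delta α b n ∧
        GSQG.lamMinus α b n ≠ GSQG.lamPlus α b n ∧
        ∀ Ω : ℝ, (GSQG.M α b Ω n).det = 0 ↔
          1 - 2 * Ω = GSQG.lamMinus α b n ∨ 1 - 2 * Ω = GSQG.lamPlus α b n) ∧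
      -- monotonicity
      StrictMonoOn (GSQG.Delta α b) (Set.Ici N) ∧
      StrictMonoOn (GSQG.lamPlus α b) (Set.Ici N) ∧
      StrictAntiOn (GSQG.lamMinus α b) (Set.Ici N) ∧
      -- no crossing
      (∀ m n : ℕ, N < n → n < m →
        GSQG.lamMinus α b m < GSQG.lamMinus α b n ∧
        GSQG.lamMinus α b n < GSQG.lamPlus α b n ∧
        GSQG.lamPlus α b n < GSQG.lamPlus α b m) :=
  mainTheorem3_general α b hα0 hα1 hb0 hb1.ne
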